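/- Let $d\ge 0$. A *convex polytope* in $\mathbb R^d$ is the convex hull of a finite set not contained in any affine hyperplane (for $d=0$: of a non-empty set), and a *generalized polytope* is a finite union of convex polytopes in $\mathbb R^d$. A *dissection* of a generalized polytope $P\subset\mathbb R^d$ is a finite collection of pairwise disjoint open $d$-dimensional simplices the closure of whose union is $P$; a point $v\in\mathbb R^d$ is a *vertex* of $P$ if, in every dissection of $P$, it is a vertex of some simplex. Let $\mathcal V(P)$ be the set of vertices of $P$. For a homogeneous polynomial $\rho$ in $d$ variables of degree $\delta\ge 0$, with real or complex coefficients, the normalized moment generating function of $P$ with density $\rho$ is the formal power series in $u=(u_1,\dots,u_d)$ $$F_P^\rho(u)=\sum_{I=(i_1,\dots,i_d)\ge 0}\frac{(|I|+d+\delta)!}{i_1!\cdots i_d!}\left(\int_P x^I\rho(x)\,dx\right)u^I .$$ **Proposition 1.7.** For every generalized polytope $P\subset\mathbb R^d$ and every homogeneous polynomial $\rho$ of degree $\delta$, the set $\mathcal V(P)$ is finite, and $F_P^\rho$ is (the power series expansion at $0$ of) a rational function whose denominator, when it is written in lowest terms, divides $$\prod_{v\in\mathcal V(P)}\bigl(1-\langle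 v,u\rangle\bigr)^{\delta+1}.$$ This applies even when $P$ has no dissection all of whose simplices have their vertices in $\mathcal V(P)$. -/

import Mathlib

open MvPolynomial

namespace PolytopeMoments

/-- A convex polytope in `ℝ^d`: the convex hull of a finite set that is not contained in any
affine hyperplane. -/
def IsConvexPolytope {d : ℕ} (P : Set (EuclideanSpace ℝ (Fin d))) : Prop :=
  ∃ S : Finset (EuclideanSpace ℝ (Fin d)),
    affineSpan ℝ (S : Set (EuclideanSpace ℝ (Fin d))) = ⊤ ∧
      P = convexHull ℝ (S : Set (EuclideanSpace ℝ (Fin d)))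

/-- A generalized polytope: a finite union of (`d`-dimensional) convex polytopes. -/
def IsGeneralizedPolytope {d : ℕ} (P : Set (EuclideanSpace ℝ (Fin d))) : Prop :=
  ∃ 𝒬 : Set (Set (EuclideanSpace ℝ (Fin d))),
    𝒬.Finite ∧ (∀ Q ∈ 𝒬, IsConvexPolytope Q) ∧ P = ⋃₀ 𝒬

/-- The open `d`-simplex spanned by `d + 1` affinely independent points of `ℝ^d`: the topological
interior of their convex hull. -/
def openSimplex {d : ℕ} (s : Affine.Simplex ℝ (EuclideanSpace ℝ (Fin d)) d) :
    Set (EuclideanSpace ℝ (Fin d)) :=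
  interior (convexHull ℝ (Set.range s.points))

/-- A dissection of `P`: finitely many pairwise disjoint open `d`-simplices, the closure of whose
union is `P`. -/
def IsDissection {d : ℕ} (T : Finset (Affine.Simplex ℝ (EuclideanSpace ℝ (Fin d)) d))
    (P : Set (EuclideanSpace ℝ (Fin d))) : Prop :=
  (T : Set (Affine.Simplex ℝ (EuclideanSpace ℝ (Fin d)) d)).PairwiseDisjoint openSimplex ∧
    closure (⋃ s ∈ T, openSimplex s) = P

/-- The vertices of `P`: the points that are a vertex of some simplex in every dissection of
`P`. -/
def vertices {d : ℕ} (P : Set (EuclideanSpace ℝ (Fin d))) : Set (EuclideanSpace ℝ (Fin d)) :=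
  {v | ∀ T : Finset (Affine.Simplex ℝ (EuclideanSpace ℝ (Fin d)) d), IsDissection T P →
    ∃ s ∈ T, v ∈ Set.range s.points}

/-- The moment `m_I(ρ μ) = ∫ x^I ρ(x) dμ(x)` of the measure with polynomial density `ρ` with
respect to `μ`. -/
noncomputable def moment {𝕜 : Type*} [RCLike 𝕜] {d : ℕ}
    (μ : MeasureTheory.Measure (EuclideanSpace ℝ (Fin d))) (ρ : MvPolynomial (Fin d) 𝕜)
    (I : Fin d →₀ ℕ) : 𝕜 :=
  ∫ x, (∏ j, (x j : 𝕜) ^ I j) * eval (fun j => (x j : 𝕜)) ρ ∂μ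

/-- The normalized moment generating function
`∑_I (|I| + d + δ)! / (i_1! ⋯ i_d!) m_I(ρ μ) u^I`, a formal power series in `u_1, …, u_d`. -/
noncomputable def momentGenFun {𝕜 : Type*} [RCLike 𝕜] {d : ℕ}
    (μ : MeasureTheory.Measure (EuclideanSpace ℝ (Fin d))) (δ : ℕ) (ρ : MvPolynomial (Fin d) 𝕜) :
    MvPowerSeries (Fin d) 𝕜 :=
  fun I => (((∑ j, I j) + d + δ).factorial : 𝕜) / (∏ j, ((I j).factorial : 𝕜)) * moment μ ρ I

/-- The standard measure of `P`: Lebesgue measure restricted to `P`. -/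
noncomputable def standardMeasure {d : ℕ} (P : Set (EuclideanSpace ℝ (Fin d))) :
    MeasureTheory.Measure (EuclideanSpace ℝ (Fin d)) :=
  MeasureTheory.volume.restrict P

/-- The polynomial `1 - ⟨v, u⟩` in the variables `u_1, …, u_d`. -/
noncomputable def dualForm (𝕜 : Type*) [RCLike 𝕜] {d : ℕ} (v : EuclideanSpace ℝ (Fin d)) :
    MvPolynomial (Fin d) 𝕜 :=
  1 - ∑ j, C (v j : 𝕜) * X j

/-- `F` is (the power series expansion of) a rational function whose denominator, that is, the
denominator `q` of its representation `p / q` in lowest terms, divides `Φ`. -/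
def HasDenominatorDividing {𝕜 : Type*} [Field 𝕜] {d : ℕ} (F : MvPowerSeries (Fin d) 𝕜)
    (Φ : MvPolynomial (Fin d) 𝕜) : Prop :=
  ∃ p q : MvPolynomial (Fin d) 𝕜, q ≠ 0 ∧ IsRelPrime p q ∧
    (q : MvPowerSeries (Fin d) 𝕜) * F = (p : MvPowerSeries (Fin d) 𝕜) ∧ q ∣ Φ

end PolytopeMoments

/-!
The generating function of a `d`-simplex with vertices `v_0, …, v_d` can be computed. The factor
`(|I| + d + δ)!` is a Gamma integral, and absorbing it turns the moments of the simplex into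
integrals of polynomials against `exp (-height)` over the cone on the simplex in `ℝ^d × ℝ`
(`exists_factorial_mul_integral_openSimplex`). This cone is the linear image of the orthant in
`ℝ^(d+1)`, where such integrals are given by the functional `X^a ↦ ∏ a_i!`. So the generating
function is that of a formal Laplace transform, and integration by parts in one variable at a time
shows that the density `X^a` in the coordinates of the orthant contributes a multiple of
`∏ i, (1 - ⟨v_i, u⟩)^(-(a_i + 1))` (`prod_affineForm_pow_mul_coneSeries`). A homogeneous density of
degree `δ` only involves `a_i ≤ δ`.

Summing over a dissection `T` of `P`, the product of `(1 - ⟨v, u⟩)^(δ + 1)` over the vertices `v` of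
the simplices in `T` is a denominator of the generating function of `P`
(`IsDissection.exists_mul_momentGenFun`). The reduced denominator divides all these products. The
forms `1 - ⟨v, u⟩` of distinct points are relatively prime (`isRelPrime_dualForm`), so a point that
is missed by some dissection does not contribute to it, and only `vertices P` remains.

This needs one dissection to exist, which also gives the finiteness of `vertices P`
(`IsGeneralizedPolytope.exists_isDissection`). By Carathéodory's theorem `P` is a finite union of
simplices that may overlap. They are added one at a time: a new simplex is cut along the facet
hyperplanes of the old ones, by repeated bisection at points of its edges, and the pieces inside the
old simplices are dropped.
-/

namespace PolytopeMoments

/-! ### Simplices in barycentric coordinates -/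

section Dissections

open Set

variable {d : ℕ}

/-- The vertices of a `d`-simplex in `ℝ^d`, as an affine basis of the space. -/
noncomputable def simplexBasis (s : Affine.Simplex ℝ (EuclideanSpace ℝ (Fin d)) d) :
    AffineBasis (Fin (d + 1)) ℝ (EuclideanSpace ℝ (Fin d)) where
  toFun := s.points
  ind' := s.independent
  tot' := by
    rw [s.independent.affineSpan_eq_top_iff_card_eq_finrank_add_one]
    simp

@[simp]
lemma coe_simplexBasis (s : Affine.Simplex ℝ (EuclideanSpace ℝ (Fin d)) d) :
    ⇑(simplexBasis s) = s.points := rfl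

/-- The closed simplex spanned by the vertices of `s`. -/
def closedSimplex (s : Affine.Simplex ℝ (EuclideanSpace ℝ (Fin d)) d) :
    Set (EuclideanSpace ℝ (Fin d)) :=
  convexHull ℝ (range s.points)

lemma mem_openSimplex {s : Affine.Simplex ℝ (EuclideanSpace ℝ (Fin d)) d}
    {x : EuclideanSpace ℝ (Fin d)} :
    x ∈ openSimplex s ↔ ∀ i, 0 < (simplexBasis s).coord i x := by
  have h := (simplexBasis s).interior_convexHull
  rw [coe_simplexBasis] at h
  rw [openSimplex, h]
  rfl

lemma mem_closedSimplex {s : Affine.Simplex ℝ (EuclideanSpace ℝ (Fin d)) d}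
    {x : EuclideanSpace ℝ (Fin d)} :
    x ∈ closedSimplex s ↔ ∀ i, 0 ≤ (simplexBasis s).coord i x := by
  have h := (simplexBasis s).convexHull_eq_nonneg_coord
  rw [coe_simplexBasis] at h
  rw [closedSimplex, h]
  rfl

lemma convex_closedSimplex (s : Affine.Simplex ℝ (EuclideanSpace ℝ (Fin d)) d) :
    Convex ℝ (closedSimplex s) :=
  convex_convexHull ℝ _

lemma isCompact_closedSimplex (s : Affine.Simplex ℝ (EuclideanSpace ℝ (Fin d)) d) :
    IsCompact (closedSimplex s) :=
  (finite_range s.points).isCompact_convexHull ℝ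

lemma isOpen_openSimplex (s : Affine.Simplex ℝ (EuclideanSpace ℝ (Fin d)) d) :
    IsOpen (openSimplex s) :=
  isOpen_interior

lemma openSimplex_subset_closedSimplex (s : Affine.Simplex ℝ (EuclideanSpace ℝ (Fin d)) d) :
    openSimplex s ⊆ closedSimplex s :=
  interior_subset

lemma openSimplex_nonempty (s : Affine.Simplex ℝ (EuclideanSpace ℝ (Fin d)) d) :
    (openSimplex s).Nonempty :=
  ⟨_, (simplexBasis s).centroid_mem_interior_convexHull⟩

lemma closure_openSimplex (s : Affine.Simplex ℝ (EuclideanSpace ℝ (Fin d)) d) :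
    closure (openSimplex s) = closedSimplex s := by
  have h := (convex_closedSimplex s).closure_interior_eq_closure_of_nonempty_interior
    (openSimplex_nonempty s)
  exact h.trans (isCompact_closedSimplex s).isClosed.closure_eq

lemma isDissection_iff {T : Finset (Affine.Simplex ℝ (EuclideanSpace ℝ (Fin d)) d)}
    {P : Set (EuclideanSpace ℝ (Fin d))} :
    IsDissection T P ↔
      (T : Set (Affine.Simplex ℝ (EuclideanSpace ℝ (Fin d)) d)).PairwiseDisjoint openSimplex ∧
        ⋃ s ∈ T, closedSimplex s = P := by
  have h := T.finite_toSet.closure_biUnion openSimplex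
  simp only [closure_openSimplex, Finset.mem_coe] at h
  rw [IsDissection, h]

lemma IsDissection.closedSimplex_subset
    {T : Finset (Affine.Simplex ℝ (EuclideanSpace ℝ (Fin d)) d)}
    {P : Set (EuclideanSpace ℝ (Fin d))} (hT : IsDissection T P)
    {s : Affine.Simplex ℝ (EuclideanSpace ℝ (Fin d)) d} (hs : s ∈ T) : closedSimplex s ⊆ P := by
  rw [← (isDissection_iff.1 hT).2]
  exact subset_biUnion_of_mem (u := closedSimplex) hs

lemma openSimplex_subset_of_closedSimplex_subset
    {s t : Affine.Simplex ℝ (EuclideanSpace ℝ (Fin d)) d} (h : closedSimplex s ⊆ closedSimplex t) :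
    openSimplex s ⊆ openSimplex t :=
  interior_mono h

lemma isDissection_singleton (s : Affine.Simplex ℝ (EuclideanSpace ℝ (Fin d)) d) :
    IsDissection {s} (closedSimplex s) := by
  rw [isDissection_iff]
  simp

/-- Dissecting every simplex of a dissection gives a dissection of the same set. -/
lemma IsDissection.biUnion [DecidableEq (Affine.Simplex ℝ (EuclideanSpace ℝ (Fin d)) d)]
    {T : Finset (Affine.Simplex ℝ (EuclideanSpace ℝ (Fin d)) d)}
    {P : Set (EuclideanSpace ℝ (Fin d))} (hT : IsDissection T P)
    {f : Affine.Simplex ℝ (EuclideanSpace ℝ (Fin d)) d →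
      Finset (Affine.Simplex ℝ (EuclideanSpace ℝ (Fin d)) d)}
    (hf : ∀ s ∈ T, IsDissection (f s) (closedSimplex s)) : IsDissection (T.biUnion f) P := by
  have hT' := isDissection_iff.1 hT
  refine isDissection_iff.2 ⟨?_, ?_⟩
  · intro a ha b hb hab
    simp only [Finset.coe_biUnion, mem_iUnion, Finset.mem_coe] at ha hb
    obtain ⟨s, hs, has⟩ := ha
    obtain ⟨t, ht, hbt⟩ := hb
    rcases eq_or_ne s t with rfl | hst
    · exact (hf s hs).1 has hbt hab
    · exact (hT'.1 hs ht hst).mono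
        (openSimplex_subset_of_closedSimplex_subset ((hf s hs).closedSimplex_subset has))
        (openSimplex_subset_of_closedSimplex_subset ((hf t ht).closedSimplex_subset hbt))
  · rw [← hT'.2, Finset.set_biUnion_biUnion]
    exact iUnion₂_congr fun s hs => (isDissection_iff.1 (hf s hs)).2

/-! ### Cutting a simplex along an affine function -/

/-- The simplex obtained from `s` by moving the vertex `i` to the point
`(1 - θ) s_i + θ s_j` of the edge from `s_i` to `s_j`. -/
noncomputable def edgeCut (s : Affine.Simplex ℝ (EuclideanSpace ℝ (Fin d)) d) {i j : Fin (d + 1)}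
    (hij : i ≠ j) {θ : ℝ} (hθ : θ ≠ 1) : Affine.Simplex ℝ (EuclideanSpace ℝ (Fin d)) d where
  points := Function.update s.points i (AffineMap.lineMap (s.points i) (s.points j) θ)
  independent := by
    refine s.independent.affineIndependent_update_of_notMem_affineSpan fun hmem => ?_
    -- on the span of the other vertices the coordinate `i` vanishes, at the new point it is `1 - θ`
    have key : ∀ x ∈ affineSpan ℝ (s.points '' {x | x ≠ i}), (simplexBasis s).coord i x = 0 := by
      have : affineSpan ℝ (s.points '' {x | x ≠ i}) ≤
          (AffineSubspace.mk' (0 : ℝ) ⊥).comap ((simplexBasis s).coord i) := by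
        rw [affineSpan_le]
        rintro _ ⟨k, hk, rfl⟩
        have := (simplexBasis s).coord_apply_ne (Ne.symm hk)
        simpa using this
      intro x hx
      simpa using this hx
    have h := key _ hmem
    rw [AffineMap.apply_lineMap] at h
    have h1 := (simplexBasis s).coord_apply_eq i
    have h2 := (simplexBasis s).coord_apply_ne hij
    rw [coe_simplexBasis] at h1 h2
    rw [h1, h2, AffineMap.lineMap_apply_ring] at h
    apply hθ
    linarith

lemma coord_edgeCut (s : Affine.Simplex ℝ (EuclideanSpace ℝ (Fin d)) d) {i j : Fin (d + 1)}
    (hij : i ≠ j) {θ : ℝ} (hθ : θ ≠ 1) (l : Fin (d + 1)) (x : EuclideanSpace ℝ (Fin d)) :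
    (simplexBasis s).coord l x = (if l = i then 0 else (simplexBasis (edgeCut s hij hθ)).coord l x)
      + (simplexBasis (edgeCut s hij hθ)).coord i x *
        ((1 - θ) * (if l = i then 1 else 0) + θ * (if l = j then 1 else 0)) := by
  set b := simplexBasis s with hb
  set c := simplexBasis (edgeCut s hij hθ) with hc
  have h := congrFun (b.toMatrix_vecMul_coords c x) l
  rw [AffineBasis.coords_apply] at h
  rw [← h, Matrix.vecMul, dotProduct, ← Finset.add_sum_erase _ _ (Finset.mem_univ i), add_comm]
  congr 1
  · have : ∀ k ∈ Finset.univ.erase i, c.coords x k * b.toMatrix c k l =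
        if l = k then c.coord k x else 0 := by
      intro k hk
      have hki : k ≠ i := (Finset.mem_erase.1 hk).1
      have : c k = b k := by
        simp [hc, hb, edgeCut, Function.update_of_ne hki]
      rw [AffineBasis.toMatrix_apply, this, b.coord_apply, AffineBasis.coords_apply]
      split_ifs <;> simp
    rw [Finset.sum_congr rfl this, Finset.sum_ite_eq]
    by_cases hl : l = i <;> simp [hl]
  · have : c i = AffineMap.lineMap (b i) (b j) θ := by
      simp [hc, hb, edgeCut]
    rw [AffineBasis.toMatrix_apply, this, AffineMap.apply_lineMap, b.coord_apply, b.coord_apply,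
      AffineMap.lineMap_apply_ring, AffineBasis.coords_apply]

/-- Cutting at `θ` keeps the part of `s` on one side of the hyperplane
`(1 - θ) x_j = θ x_i`. -/
lemma forall_coord_edgeCut (s : Affine.Simplex ℝ (EuclideanSpace ℝ (Fin d)) d) {i j : Fin (d + 1)}
    (hij : i ≠ j) {θ : ℝ} (hθ : θ ≠ 1) (h1 : θ < 1) (x : EuclideanSpace ℝ (Fin d)) :
    ((∀ k, 0 < (simplexBasis (edgeCut s hij hθ)).coord k x) ↔
      (∀ k, k ≠ j → 0 < (simplexBasis s).coord k x) ∧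
        0 < (1 - θ) * (simplexBasis s).coord j x - θ * (simplexBasis s).coord i x) ∧
    ((∀ k, 0 ≤ (simplexBasis (edgeCut s hij hθ)).coord k x) ↔
      (∀ k, k ≠ j → 0 ≤ (simplexBasis s).coord k x) ∧
        0 ≤ (1 - θ) * (simplexBasis s).coord j x - θ * (simplexBasis s).coord i x) := by
  set b := simplexBasis s with hb
  set c := simplexBasis (edgeCut s hij hθ) with hc
  have hθ' : 0 < 1 - θ := by linarith
  have hk : ∀ k, k ≠ i → k ≠ j → b.coord k x = c.coord k x := fun k hki hkj => by
    simpa [hki, hkj] using coord_edgeCut s hij hθ k x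
  have hi : b.coord i x = (1 - θ) * c.coord i x := by
    have := coord_edgeCut s hij hθ i x
    simp only [if_true, if_neg hij] at this
    rw [← hb, ← hc] at this
    linarith
  have hj : (1 - θ) * b.coord j x - θ * b.coord i x = (1 - θ) * c.coord j x := by
    have := coord_edgeCut s hij hθ j x
    simp only [if_true, if_neg hij.symm] at this
    rw [← hb, ← hc] at this
    rw [this, hi]
    ring
  rw [hj]
  constructor
  · constructor
    · refine fun h => ⟨fun k hkj => ?_, mul_pos hθ' (h j)⟩
      by_cases hki : k = i
      · rw [hki, hi]; exact mul_pos hθ' (h i)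
      · rw [hk k hki hkj]; exact h k
    · rintro ⟨h, h'⟩ k
      by_cases hkj : k = j
      · rw [hkj]; exact (mul_pos_iff_of_pos_left hθ').1 h'
      by_cases hki : k = i
      · rw [hki]; exact (mul_pos_iff_of_pos_left hθ').1 (hi ▸ h i hij)
      · rw [← hk k hki hkj]; exact h k hkj
  · constructor
    · refine fun h => ⟨fun k hkj => ?_, mul_nonneg hθ'.le (h j)⟩
      by_cases hki : k = i
      · rw [hki, hi]; exact mul_nonneg hθ'.le (h i)
      · rw [hk k hki hkj]; exact h k
    · rintro ⟨h, h'⟩ k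
      by_cases hkj : k = j
      · rw [hkj]; exact (mul_nonneg_iff_of_pos_left hθ').1 h'
      by_cases hki : k = i
      · rw [hki]; exact (mul_nonneg_iff_of_pos_left hθ').1 (hi ▸ h i hij)
      · rw [← hk k hki hkj]; exact h k hkj

/-- A point in the interior of an edge of a simplex bisects it into two simplices. -/
lemma isDissection_edgeCut [DecidableEq (Affine.Simplex ℝ (EuclideanSpace ℝ (Fin d)) d)]
    (s : Affine.Simplex ℝ (EuclideanSpace ℝ (Fin d)) d) {i j : Fin (d + 1)} (hij : i ≠ j) {θ : ℝ}
    (h0 : 0 < θ) (h1 : θ < 1) :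
    IsDissection {edgeCut s hij h1.ne, edgeCut s hij.symm (θ := 1 - θ) (by linarith)}
      (closedSimplex s) := by
  have A := forall_coord_edgeCut s hij h1.ne h1
  have B := forall_coord_edgeCut s hij.symm (θ := 1 - θ) (by linarith) (by linarith)
  rw [isDissection_iff]
  constructor
  · have hdisj : Disjoint (openSimplex (edgeCut s hij h1.ne))
        (openSimplex (edgeCut s hij.symm (θ := 1 - θ) (by linarith))) := by
      rw [disjoint_left]
      intro x hx hx'
      have h := ((A x).1.1 (mem_openSimplex.1 hx)).2
      have h' := ((B x).1.1 (mem_openSimplex.1 hx')).2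
      linarith
    rw [Finset.coe_pair, PairwiseDisjoint, pairwise_pair]
    exact fun _ => ⟨hdisj, hdisj.symm⟩
  · ext x
    simp only [Finset.mem_insert, Finset.mem_singleton, iUnion_iUnion_eq_or_left,
      iUnion_iUnion_eq_left, mem_union, mem_closedSimplex, (A x).2, (B x).2, sub_sub_cancel]
    have e : θ * (simplexBasis s).coord i x - (1 - θ) * (simplexBasis s).coord j x =
      -((1 - θ) * (simplexBasis s).coord j x - θ * (simplexBasis s).coord i x) := by ring
    rw [e]
    constructor
    · rintro (⟨h, h'⟩ | ⟨h, h'⟩) k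
      · by_cases hk : k = j
        · have := mul_nonneg h0.le (h i hij)
          rw [hk]
          exact (mul_nonneg_iff_of_pos_left (sub_pos.2 h1)).1 (by linarith)
        · exact h k hk
      · by_cases hk : k = i
        · have := mul_nonneg (sub_pos.2 h1).le (h j hij.symm)
          rw [hk]
          exact (mul_nonneg_iff_of_pos_left h0).1 (by linarith)
        · exact h k hk
    · intro h
      rcases le_total 0 ((1 - θ) * (simplexBasis s).coord j x - θ * (simplexBasis s).coord i x)
        with h' | h'
      · exact Or.inl ⟨fun k _ => h k, h'⟩
      · exact Or.inr ⟨fun k _ => h k, by linarith⟩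

/-- An affine function that is nonnegative at the vertices of `s` is nonnegative on `s`. -/
lemma nonneg_on_closedSimplex (s : Affine.Simplex ℝ (EuclideanSpace ℝ (Fin d)) d)
    (h : EuclideanSpace ℝ (Fin d) →ᵃ[ℝ] ℝ) (hs : ∀ i, 0 ≤ h (s.points i)) :
    ∀ x ∈ closedSimplex s, 0 ≤ h x := by
  have : closedSimplex s ⊆ h ⁻¹' Ici 0 :=
    convexHull_min (by rintro _ ⟨i, rfl⟩; exact hs i) ((convex_Ici 0).affine_preimage h)
  exact fun x hx => this hx

/-- Every simplex has a dissection into simplices that do not cross a given hyperplane: as long as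
an edge crosses the hyperplane, cut at its intersection point, which lowers the number of vertices
off the hyperplane. -/
lemma exists_isDissection_affineMap (h : EuclideanSpace ℝ (Fin d) →ᵃ[ℝ] ℝ)
    (s : Affine.Simplex ℝ (EuclideanSpace ℝ (Fin d)) d) :
    ∃ T, IsDissection T (closedSimplex s) ∧ ∀ t ∈ T,
      (∀ x ∈ closedSimplex t, 0 ≤ h x) ∨ ∀ x ∈ closedSimplex t, h x ≤ 0 := by
  classical
  induction hn : (Finset.univ.filter fun k => h (s.points k) ≠ 0).card using
    Nat.strong_induction_on generalizing s with
  | _ n ih =>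
    by_cases hpos : ∀ i, 0 ≤ h (s.points i)
    · refine ⟨{s}, isDissection_singleton s, fun t ht => Or.inl ?_⟩
      rw [Finset.mem_singleton.1 ht]
      exact nonneg_on_closedSimplex s h hpos
    by_cases hneg : ∀ i, h (s.points i) ≤ 0
    · refine ⟨{s}, isDissection_singleton s, fun t ht => Or.inr ?_⟩
      rw [Finset.mem_singleton.1 ht]
      intro x hx
      have := nonneg_on_closedSimplex s (-h) (fun i => by simpa using hneg i) x hx
      simpa using this
    push Not at hpos hneg
    obtain ⟨i, hi⟩ := hpos
    obtain ⟨j, hj⟩ := hneg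
    have hij : i ≠ j := by
      rintro rfl
      exact lt_asymm hi hj
    have hlt : 0 < h (s.points j) - h (s.points i) := by linarith
    -- `h` vanishes on the edge from `s_i` to `s_j` at the parameter `θ`
    obtain ⟨θ, hθ⟩ : ∃ θ, θ = -h (s.points i) / (h (s.points j) - h (s.points i)) := ⟨_, rfl⟩
    have h0 : 0 < θ := by rw [hθ]; exact div_pos (by linarith) hlt
    have h1 : θ < 1 := by rw [hθ, div_lt_one hlt]; linarith
    have hzero : θ * (h (s.points j) - h (s.points i)) + h (s.points i) = 0 := by
      rw [hθ, div_mul_cancel₀ _ hlt.ne']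
      ring
    have hcard : ∀ (a b : Fin (d + 1)) (hab : a ≠ b) (τ : ℝ) (hτ : τ ≠ 1), h (s.points a) ≠ 0 →
        τ * (h (s.points b) - h (s.points a)) + h (s.points a) = 0 →
        (Finset.univ.filter fun k => h ((edgeCut s hab hτ).points k) ≠ 0).card < n := by
      intro a b hab τ hτ ha hz
      rw [← hn]
      have hval : h ((edgeCut s hab hτ).points a) = 0 := by
        rw [← hz]
        simp only [edgeCut, Function.update_self]
        rw [AffineMap.apply_lineMap, AffineMap.lineMap_apply]
        rfl
      refine Finset.card_lt_card ⟨fun k hk => ?_, fun hsub => ?_⟩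
      · rw [Finset.mem_filter] at hk ⊢
        refine ⟨hk.1, ?_⟩
        by_cases hka : k = a
        · rwa [hka]
        · simpa [edgeCut, Function.update_of_ne hka] using hk.2
      · exact (Finset.mem_filter.1 (hsub (Finset.mem_filter.2 ⟨Finset.mem_univ a, ha⟩))).2 hval
    obtain ⟨T₁, hT₁, hs₁⟩ := ih _ (hcard i j hij θ h1.ne hi.ne hzero) (edgeCut s hij h1.ne) rfl
    obtain ⟨T₂, hT₂, hs₂⟩ := ih _ (hcard j i hij.symm (1 - θ) (by linarith) hj.ne'
      (by linarith)) (edgeCut s hij.symm (θ := 1 - θ) (by linarith)) rfl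
    set s₁ := edgeCut s hij h1.ne
    set s₂ := edgeCut s hij.symm (θ := 1 - θ) (by linarith)
    have hD : IsDissection {s₁, s₂} (closedSimplex s) := isDissection_edgeCut s hij h0 h1
    have hf : ∀ t ∈ ({s₁, s₂} : Finset _), ∃ T, IsDissection T (closedSimplex t) ∧ ∀ t ∈ T,
        (∀ x ∈ closedSimplex t, 0 ≤ h x) ∨ ∀ x ∈ closedSimplex t, h x ≤ 0 := by
      intro t ht
      rcases Finset.mem_insert.1 ht with rfl | ht
      · exact ⟨T₁, hT₁, hs₁⟩
      · rw [Finset.mem_singleton.1 ht]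
        exact ⟨T₂, hT₂, hs₂⟩
    choose! f hf hf' using hf
    refine ⟨_, hD.biUnion hf, fun t ht => ?_⟩
    obtain ⟨r, hr, htr⟩ := Finset.mem_biUnion.1 ht
    exact hf' r hr t htr

lemma exists_isDissection_affineMaps {κ : Type*} (K : Finset κ)
    (h : κ → EuclideanSpace ℝ (Fin d) →ᵃ[ℝ] ℝ)
    (s : Affine.Simplex ℝ (EuclideanSpace ℝ (Fin d)) d) :
    ∃ T, IsDissection T (closedSimplex s) ∧ ∀ t ∈ T, ∀ k ∈ K,
      (∀ x ∈ closedSimplex t, 0 ≤ h k x) ∨ ∀ x ∈ closedSimplex t, h k x ≤ 0 := by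
  classical
  induction K using Finset.induction_on with
  | empty => exact ⟨{s}, isDissection_singleton s, by simp⟩
  | insert k K _ ih =>
    obtain ⟨T, hT, hTK⟩ := ih
    choose f hf hf' using exists_isDissection_affineMap (h k)
    refine ⟨_, hT.biUnion fun t _ => hf t, fun t ht l hl => ?_⟩
    obtain ⟨r, hr, htr⟩ := Finset.mem_biUnion.1 ht
    rcases Finset.mem_insert.1 hl with rfl | hl
    · exact hf' r t htr
    · have hsub := (hf r).closedSimplex_subset htr
      exact (hTK r hr l hl).imp (fun H x hx => H x (hsub hx)) fun H x hx => H x (hsub hx)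

/-! ### Dissections of generalized polytopes -/

/-- The new simplex is cut along the facets of the old ones; a piece then lies in an old simplex,
and is discarded, or its interior misses the interiors of all of them. -/
lemma IsDissection.exists_union {T : Finset (Affine.Simplex ℝ (EuclideanSpace ℝ (Fin d)) d)}
    {P : Set (EuclideanSpace ℝ (Fin d))} (hT : IsDissection T P)
    (s : Affine.Simplex ℝ (EuclideanSpace ℝ (Fin d)) d) :
    ∃ T', IsDissection T' (P ∪ closedSimplex s) := by
  classical
  obtain ⟨R, hR, hRT⟩ := exists_isDissection_affineMaps (T ×ˢ Finset.univ)
    (fun k : Affine.Simplex ℝ (EuclideanSpace ℝ (Fin d)) d × Fin (d + 1) =>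
      (simplexBasis k.1).coord k.2) s
  have hT' := isDissection_iff.1 hT
  have hR' := isDissection_iff.1 hR
  have hdisj : ∀ r ∈ R, ∀ t ∈ T, ¬ closedSimplex r ⊆ closedSimplex t →
      Disjoint (openSimplex r) (openSimplex t) := by
    intro r hr t ht hrt
    rw [disjoint_left]
    intro x hxr hxt
    refine hrt fun y hy => mem_closedSimplex.2 fun i => ?_
    rcases hRT r hr (t, i) (by simpa using ht) with H | H
    · exact H y hy
    · exact absurd (H x (openSimplex_subset_closedSimplex r hxr))
        (not_le.2 (mem_openSimplex.1 hxt i))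
  refine ⟨T ∪ R.filter fun r => ∀ t ∈ T, ¬ closedSimplex r ⊆ closedSimplex t,
    isDissection_iff.2 ⟨?_, ?_⟩⟩
  · intro a ha b hb hab
    simp only [Finset.coe_union, Finset.coe_filter, mem_union, Finset.mem_coe,
      mem_ofPred_eq] at ha hb
    rcases ha with ha | ⟨ha, ha'⟩ <;> rcases hb with hb | ⟨hb, hb'⟩
    · exact hT'.1 ha hb hab
    · exact (hdisj b hb a ha (hb' a ha)).symm
    · exact hdisj a ha b hb (ha' b hb)
    · exact hR'.1 ha hb hab
  · rw [← hT'.2, ← hR'.2]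
    ext x
    simp only [Finset.mem_union, Finset.mem_filter, mem_iUnion, mem_union, exists_prop]
    constructor
    · rintro ⟨r, hr | hr, hx⟩
      · exact Or.inl ⟨r, hr, hx⟩
      · exact Or.inr ⟨r, hr.1, hx⟩
    · rintro (⟨r, hr, hx⟩ | ⟨r, hr, hx⟩)
      · exact ⟨r, Or.inl hr, hx⟩
      · by_cases h : ∀ t ∈ T, ¬ closedSimplex r ⊆ closedSimplex t
        · exact ⟨r, Or.inr ⟨hr, h⟩, hx⟩
        · push Not at h
          obtain ⟨t, ht, hrt⟩ := h
          exact ⟨t, Or.inl ht, hrt hx⟩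

lemma IsDissection.exists_union_biUnion
    {T : Finset (Affine.Simplex ℝ (EuclideanSpace ℝ (Fin d)) d)}
    {P : Set (EuclideanSpace ℝ (Fin d))} (hT : IsDissection T P)
    (R : Finset (Affine.Simplex ℝ (EuclideanSpace ℝ (Fin d)) d)) :
    ∃ T', IsDissection T' (P ∪ ⋃ s ∈ R, closedSimplex s) := by
  classical
  induction R using Finset.induction_on with
  | empty => exact ⟨T, by simpa using hT⟩
  | insert s R _ ih =>
    obtain ⟨T', hT'⟩ := ih
    obtain ⟨T'', hT''⟩ := hT'.exists_union s
    refine ⟨T'', ?_⟩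
    rwa [Finset.set_biUnion_insert, union_comm (closedSimplex s), ← union_assoc]

/-- An affinely independent subset of a finite spanning set extends to an affine basis inside this
set. -/
lemma exists_simplex_of_affineIndependent {S t : Finset (EuclideanSpace ℝ (Fin d))}
    (hS : affineSpan ℝ (S : Set (EuclideanSpace ℝ (Fin d))) = ⊤) (htS : t ⊆ S)
    (ht : AffineIndependent ℝ ((↑) : t → EuclideanSpace ℝ (Fin d))) :
    ∃ s : Affine.Simplex ℝ (EuclideanSpace ℝ (Fin d)) d,
      (t : Set (EuclideanSpace ℝ (Fin d))) ⊆ range s.points ∧ range s.points ⊆ S := by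
  classical
  obtain ⟨r, hr, hmax⟩ := Finset.exists_max_image
    (S.powerset.filter fun r => t ⊆ r ∧ AffineIndependent ℝ ((↑) : r → EuclideanSpace ℝ (Fin d)))
    Finset.card ⟨t, by simp [htS, ht]⟩
  simp only [Finset.mem_filter, Finset.mem_powerset] at hr hmax
  obtain ⟨hrS, htr, hr⟩ := hr
  have hspan : affineSpan ℝ (r : Set (EuclideanSpace ℝ (Fin d))) = ⊤ := by
    rw [eq_top_iff, ← hS, affineSpan_le]
    intro p hp
    by_contra hpr
    have hpr' : p ∉ r := fun h => hpr (subset_affineSpan ℝ _ h)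
    have hind : AffineIndependent ℝ
        fun x : ↥(insert p r) => (x : EuclideanSpace ℝ (Fin d)) := by
      let i : ↥(insert p r) := ⟨p, Finset.mem_insert_self p r⟩
      let f : {y : ↥(insert p r) // y ≠ i} ↪ r :=
        ⟨fun x => ⟨x.1.1, (Finset.mem_insert.1 x.1.2).resolve_left fun h => x.2 (Subtype.ext h)⟩,
          fun x y hxy => Subtype.ext (Subtype.ext (Subtype.ext_iff.1 hxy :))⟩
      refine AffineIndependent.affineIndependent_of_notMem_span (i := i) ?_ ?_
      · exact hr.comp_embedding f
      · refine fun hmem => hpr (affineSpan_mono ℝ ?_ hmem)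
        rintro _ ⟨x, hx, rfl⟩
        exact (Finset.mem_insert.1 x.2).resolve_left fun h => hx (Subtype.ext h)
    have := hmax (insert p r) ⟨Finset.insert_subset hp hrS,
      htr.trans (Finset.subset_insert p r), hind⟩
    rw [Finset.card_insert_of_notMem hpr'] at this
    omega
  have hcard : Fintype.card r = d + 1 := by
    have := hr.affineSpan_eq_top_iff_card_eq_finrank_add_one.1 (by simpa using hspan)
    simpa using this
  let e : Fin (d + 1) ≃ r := (Fintype.equivFinOfCardEq hcard).symm
  have hrange : range (fun i => (e i : EuclideanSpace ℝ (Fin d))) = r := by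
    ext x
    constructor
    · rintro ⟨i, rfl⟩
      exact (e i).2
    · intro hx
      exact ⟨e.symm ⟨x, hx⟩, by simp⟩
  exact ⟨⟨fun i => e i, hr.comp_embedding e.toEmbedding⟩, hrange ▸ Finset.coe_subset.2 htr,
    hrange ▸ Finset.coe_subset.2 hrS⟩

/-- By Carathéodory's theorem, a convex polytope is a finite union of (possibly overlapping)
`d`-simplices. -/
lemma IsConvexPolytope.exists_eq_biUnion {Q : Set (EuclideanSpace ℝ (Fin d))}
    (hQ : IsConvexPolytope Q) :
    ∃ R : Finset (Affine.Simplex ℝ (EuclideanSpace ℝ (Fin d)) d),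
      Q = ⋃ s ∈ R, closedSimplex s := by
  obtain ⟨S, hS, rfl⟩ := hQ
  have hfin : {s : Affine.Simplex ℝ (EuclideanSpace ℝ (Fin d)) d |
      range s.points ⊆ S}.Finite := by
    have : (Set.pi univ fun _ : Fin (d + 1) =>
        (S : Set (EuclideanSpace ℝ (Fin d)))).Finite := Set.Finite.pi fun _ => S.finite_toSet
    refine (this.preimage (f := fun s : Affine.Simplex ℝ (EuclideanSpace ℝ (Fin d)) d => s.points)
      fun s _ t _ h => Affine.Simplex.ext fun i => congrFun h i).subset ?_
    exact fun s hs i _ => hs ⟨i, rfl⟩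
  refine ⟨hfin.toFinset, Subset.antisymm ?_ ?_⟩
  · rw [convexHull_eq_union]
    refine iUnion_subset fun t => iUnion_subset fun htS => iUnion_subset fun ht => ?_
    obtain ⟨s, hts, hsS⟩ := exists_simplex_of_affineIndependent hS (Finset.coe_subset.1 htS) ht
    exact (convexHull_mono hts).trans
      (subset_biUnion_of_mem (u := closedSimplex) ((Finite.mem_toFinset hfin).2 hsS))
  · exact iUnion₂_subset fun s hs => convexHull_mono ((Finite.mem_toFinset hfin).1 hs)

theorem IsGeneralizedPolytope.exists_isDissection {P : Set (EuclideanSpace ℝ (Fin d))}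
    (hP : IsGeneralizedPolytope P) : ∃ T, IsDissection T P := by
  obtain ⟨𝒬, hfin, hconv, rfl⟩ := hP
  induction 𝒬, hfin using Set.Finite.induction_on with
  | empty => exact ⟨∅, by simp [isDissection_iff]⟩
  | insert _ _ ih =>
    obtain ⟨T, hT⟩ := ih fun Q hQ => hconv Q (mem_insert_of_mem _ hQ)
    obtain ⟨R, hR⟩ := (hconv _ (mem_insert _ _)).exists_eq_biUnion
    obtain ⟨T', hT'⟩ := hT.exists_union_biUnion R
    refine ⟨T', ?_⟩
    rwa [sUnion_insert, union_comm, hR]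

end Dissections

section FormalLaplace

variable {K ι σ : Type*} [Field K] [Fintype ι]

/-! ### The formal Laplace functional -/

lemma prod_factorial_eq {κ : Type*} [Fintype κ] (a : κ →₀ ℕ) {i : κ} (hi : a i ≠ 0) :
    ∏ k, ((a k).factorial : K) =
      a i * ∏ k, (((a - Finsupp.single i 1 : κ →₀ ℕ) k).factorial : K) := by
  classical
  rw [← Finset.mul_prod_erase _ _ (Finset.mem_univ i),
    ← Finset.mul_prod_erase _
      (fun k => (((a - Finsupp.single i 1 : κ →₀ ℕ) k).factorial : K)) (Finset.mem_univ i),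
    ← mul_assoc]
  congr 1
  · rw [← Nat.mul_factorial_pred hi]
    simp
  · refine Finset.prod_congr rfl fun k hk => ?_
    rw [Finsupp.tsub_apply, Finsupp.single_eq_of_ne (Finset.ne_of_mem_erase hk), tsub_zero]

/-- The linear functional `X^a ↦ ∏ a_i!`, which over the reals is integration against
`exp (-∑ X_i)` over the positive orthant. -/
noncomputable def laplaceFunctional (K ι : Type*) [Field K] [Fintype ι] :
    MvPolynomial ι K →ₗ[K] K :=
  (basisMonomials ι K).constr K fun a => ∏ i, ((a i).factorial : K)

lemma laplaceFunctional_monomial (a : ι →₀ ℕ) (c : K) :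
    laplaceFunctional K ι (monomial a c) = c * ∏ i, ((a i).factorial : K) := by
  have h : monomial a c = c • basisMonomials ι K a := by simp [smul_monomial]
  rw [h, map_smul, laplaceFunctional, Module.Basis.constr_basis, smul_eq_mul]

/-- Substitution of `0` for the variable `X_i`. -/
noncomputable def substZero [DecidableEq ι] (i : ι) : MvPolynomial ι K →ₐ[K] MvPolynomial ι K :=
  aeval (Function.update X i 0)

lemma substZero_monomial [DecidableEq ι] (i : ι) (a : ι →₀ ℕ) (c : K) :
    substZero i (monomial a c) = if a i = 0 then monomial a c else 0 := by
  rw [substZero, aeval_monomial, Finsupp.prod_fintype _ _ (by simp)]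
  split_ifs with h
  · have : ∀ k, Function.update X i (0 : MvPolynomial ι K) k ^ a k = X k ^ a k := by
      intro k
      by_cases hk : k = i
      · rw [hk, h]; simp
      · rw [Function.update_of_ne hk]
    rw [Finset.prod_congr rfl fun k _ => this k, monomial_eq, algebraMap_eq,
      Finsupp.prod_fintype _ _ (by simp)]
  · rw [Finset.prod_eq_zero (Finset.mem_univ i) (by simp [h]), mul_zero]

/-- Integration by parts in the variable `X_i`. -/
lemma laplaceFunctional_sub_pderiv [DecidableEq ι] (i : ι) (h : MvPolynomial ι K) :
    laplaceFunctional K ι h - laplaceFunctional K ι (pderiv i h) =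
      laplaceFunctional K ι (substZero i h) := by
  induction h using MvPolynomial.induction_on' with
  | monomial a c =>
    rw [substZero_monomial, pderiv_monomial]
    split_ifs with h0
    · simp [h0]
    · rw [laplaceFunctional_monomial, laplaceFunctional_monomial, map_zero, sub_eq_zero,
        prod_factorial_eq a h0, mul_assoc]
  | add p q hp hq =>
    simp only [map_add, ← hp, ← hq]
    ring

/-! ### The generating function of a cone -/

/-- The linear forms `y_j = ∑ i, v_{ij} X_i`, the coordinates of the point `∑ i, X_i v_i`. -/
noncomputable def coneForm (v : ι → σ → K) (j : σ) : MvPolynomial ι K :=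
  ∑ i, C (v i j) * X i

lemma substZero_coneForm [DecidableEq ι] (v : ι → σ → K) (i : ι) (j : σ) :
    substZero i (coneForm v j) = coneForm (Function.update v i 0) j := by
  simp only [coneForm, map_sum, map_mul, substZero, aeval_X, algHom_C, algebraMap_eq]
  refine Finset.sum_congr rfl fun k _ => ?_
  by_cases hk : k = i
  · subst hk; simp
  · simp [Function.update_of_ne hk]

lemma pderiv_coneForm (v : ι → σ → K) (i : ι) (j : σ) :
    pderiv i (coneForm v j) = C (v i j) := by
  classical
  simp only [coneForm, map_sum, pderiv_C_mul, pderiv_X]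
  rw [Finset.sum_eq_single i]
  · simp
  · intro k _ hk
    simp [hk]
  · simp

variable [Fintype σ]

/-- The chain rule for the substitution `u_j ↦ y_j`. -/
lemma pderiv_aeval_coneForm (v : ι → σ → K) (i : ι) (p : MvPolynomial σ K) :
    pderiv i (aeval (coneForm v) p) =
      ∑ j, C (v i j) * aeval (coneForm v) (pderiv j p) := by
  classical
  induction p using MvPolynomial.induction_on with
  | C c => simp
  | add p q hp hq => simp only [map_add, hp, hq, mul_add, Finset.sum_add_distrib]
  | mul_X p k hp =>
    simp only [map_mul, aeval_X, pderiv_mul, hp, pderiv_coneForm, map_add, pderiv_X, mul_add,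
      Finset.sum_add_distrib]
    congr 1
    · rw [Finset.sum_mul]
      exact Finset.sum_congr rfl fun j _ => by ring
    · rw [Finset.sum_eq_single k]
      · simp [mul_comm]
      · intro j _ hj
        simp [hj.symm]
      · simp

/-- The formal power series `∑_I L(y^I g) u^I / I!`, where `L` is the formal Laplace functional:
the value of `L` at `g · exp (∑ j, y_j u_j)`. -/
noncomputable def coneSeries (v : ι → σ → K) : MvPolynomial ι K →ₗ[K] MvPowerSeries σ K :=
  LinearMap.pi fun I => (∏ j, ((I j).factorial : K))⁻¹ • (laplaceFunctional K ι ∘ₗ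
    LinearMap.mulLeft K (aeval (coneForm v) (monomial I (1 : K))))

lemma coeff_coneSeries (v : ι → σ → K) (g : MvPolynomial ι K) (I : σ →₀ ℕ) :
    MvPowerSeries.coeff I (coneSeries v g) = (∏ j, ((I j).factorial : K))⁻¹ *
      laplaceFunctional K ι (aeval (coneForm v) (monomial I (1 : K)) * g) := rfl

/-- The polynomial `1 - ∑ j, w_j u_j`, which is `dualForm` with coefficients in any field. -/
noncomputable def affineForm (w : σ → K) : MvPolynomial σ K :=
  1 - ∑ j, C (w j) * X j

lemma coeff_affineForm_mul [DecidableEq σ] (w : σ → K) (F : MvPowerSeries σ K) (I : σ →₀ ℕ) :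
    MvPowerSeries.coeff I ((affineForm w : MvPowerSeries σ K) * F) =
      MvPowerSeries.coeff I F - ∑ j, w j * if I j = 0 then 0 else
        MvPowerSeries.coeff (I - Finsupp.single j 1) F := by
  have h : (affineForm w : MvPowerSeries σ K) =
      1 - ∑ j, MvPowerSeries.monomial (Finsupp.single j 1) (w j) := by
    have := map_sub (coeToMvPowerSeries.ringHom (σ := σ) (R := K)) 1 (∑ j, C (w j) * X j)
    simpa only [affineForm, coeToMvPowerSeries.ringHom_apply, map_sum, C_mul_X_eq_monomial,
      coe_monomial, coe_one, map_one] using this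
  rw [h, sub_mul, one_mul, map_sub, Finset.sum_mul, map_sum]
  congr 1
  refine Finset.sum_congr rfl fun j _ => ?_
  rw [MvPowerSeries.coeff_monomial_mul]
  by_cases hj : I j = 0
  · simp [hj]
  · rw [if_pos (Finsupp.single_le_iff.2 (Nat.one_le_iff_ne_zero.2 hj)), if_neg hj]

variable [CharZero K]

/-- Integration by parts for the generating function. -/
lemma affineForm_mul_coneSeries [DecidableEq ι] (v : ι → σ → K) (i : ι) (g : MvPolynomial ι K) :
    (affineForm (v i) : MvPowerSeries σ K) * coneSeries v g =
      coneSeries v (pderiv i g) + coneSeries (Function.update v i 0) (substZero i g) := by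
  classical
  ext I
  rw [coeff_affineForm_mul, map_add]
  simp only [coeff_coneSeries]
  have hfac : ∀ j, (if I j = 0 then 0 else
      (∏ k, (((I - Finsupp.single j 1 : σ →₀ ℕ) k).factorial : K))⁻¹ * laplaceFunctional K ι
        (aeval (coneForm v) (monomial (I - Finsupp.single j 1) (1 : K)) * g)) =
      (∏ k, ((I k).factorial : K))⁻¹ * laplaceFunctional K ι
        (aeval (coneForm v) (pderiv j (monomial I (1 : K))) * g) := by
    intro j
    rw [pderiv_monomial, one_mul]
    split_ifs with h0
    · simp [h0]
    · have h1 : monomial (I - Finsupp.single j 1) (I j : K) =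
          (I j : K) • monomial (I - Finsupp.single j 1) (1 : K) := by simp [smul_monomial]
      have h3 : (I j : K) ≠ 0 := Nat.cast_ne_zero.2 h0
      rw [h1, prod_factorial_eq I h0, map_smul, smul_mul_assoc, map_smul, smul_eq_mul, mul_inv]
      field_simp
  simp only [hfac]
  have hparts := laplaceFunctional_sub_pderiv i (aeval (coneForm v) (monomial I (1 : K)) * g)
  have hsub : substZero i (aeval (coneForm v) (monomial I (1 : K)) * g) =
      aeval (coneForm (Function.update v i 0)) (monomial I (1 : K)) * substZero i g := by
    rw [map_mul, ← AlgHom.comp_apply, comp_aeval]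
    simp only [substZero_coneForm]
  have hsum : laplaceFunctional K ι
      ((∑ j, C (v i j) * aeval (coneForm v) (pderiv j (monomial I (1 : K)))) * g) =
      ∑ j, v i j * laplaceFunctional K ι
        (aeval (coneForm v) (pderiv j (monomial I (1 : K))) * g) := by
    rw [Finset.sum_mul, map_sum]
    refine Finset.sum_congr rfl fun j _ => ?_
    rw [C_mul', smul_mul_assoc, map_smul, smul_eq_mul]
  rw [pderiv_mul, hsub, map_add, pderiv_aeval_coneForm, hsum] at hparts
  have : ∀ c : K, ∑ j, v i j * (c * laplaceFunctional K ι
      (aeval (coneForm v) (pderiv j (monomial I (1 : K))) * g)) =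
      c * ∑ j, v i j * laplaceFunctional K ι
      (aeval (coneForm v) (pderiv j (monomial I (1 : K))) * g) := by
    intro c
    rw [Finset.mul_sum]
    exact Finset.sum_congr rfl fun j _ => by ring
  rw [this]
  linear_combination (∏ j, ((I j).factorial : K))⁻¹ * hparts

lemma affineForm_pow_mul_coneSeries [DecidableEq ι] (v : ι → σ → K) (i : ι) (a : ι →₀ ℕ) :
    (affineForm (v i) : MvPowerSeries σ K) ^ (a i + 1) * coneSeries v (monomial a 1) =
      ((a i).factorial : K) • coneSeries (Function.update v i 0) (monomial (a.erase i) 1) := by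
  induction hn : a i generalizing a with
  | zero =>
    have : a.erase i = a := Finsupp.erase_of_notMem_support (by simpa using hn)
    rw [zero_add, pow_one, affineForm_mul_coneSeries, pderiv_monomial, substZero_monomial, hn, this]
    ext I
    simp [coeff_coneSeries]
  | succ n ih =>
    have ha : (a - Finsupp.single i 1 : ι →₀ ℕ) i = n := by simp [hn]
    have he : (a - Finsupp.single i 1).erase i = a.erase i := by
      ext k
      by_cases hk : k = i
      · simp [hk]
      · simp [Finsupp.erase_ne hk, Finsupp.single_eq_of_ne hk]
    have hm : monomial (a - Finsupp.single i 1) (1 * (a i : K)) =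
        (a i : K) • monomial (a - Finsupp.single i 1) (1 : K) := by simp [smul_monomial]
    rw [pow_succ, mul_assoc, affineForm_mul_coneSeries, pderiv_monomial, substZero_monomial,
      if_neg (by omega), map_zero, add_zero, hm, map_smul, mul_smul_comm, ih _ ha, he, smul_smul,
      hn, Nat.factorial_succ, Nat.cast_mul]

/-- The generating function of `g = X^a` is `∏ i, a_i! / (1 - ⟨v_i, u⟩)^(a_i + 1)`. -/
lemma prod_affineForm_pow_mul_coneSeries (v : ι → σ → K) (a : ι →₀ ℕ) :
    (∏ i, (affineForm (v i) : MvPowerSeries σ K) ^ (a i + 1)) * coneSeries v (monomial a 1) =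
      MvPowerSeries.C (∏ i, ((a i).factorial : K)) := by
  classical
  have key : ∀ S : Finset ι, (∏ i ∈ S, (affineForm (v i) : MvPowerSeries σ K) ^ (a i + 1)) *
      coneSeries v (monomial a 1) = (∏ i ∈ S, ((a i).factorial : K)) •
        coneSeries (fun i => if i ∈ S then 0 else v i)
          (monomial (a.filter fun i => i ∉ S) 1) := by
    intro S
    induction S using Finset.induction_on with
    | empty =>
      have : (a.filter fun i => i ∉ (∅ : Finset ι)) = a := by
        ext k
        simp
      rw [this]
      simp
    | insert i S hi ih =>
      have h := affineForm_pow_mul_coneSeries (fun i => if i ∈ S then 0 else v i) i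
        (a.filter fun i => i ∉ S)
      rw [Finsupp.filter_apply_pos (fun i => i ∉ S) _ hi] at h
      simp only [if_neg hi] at h
      have hv : Function.update (fun i => if i ∈ S then 0 else v i) i 0 =
          fun k => if k ∈ insert i S then 0 else v k := by
        ext1 k
        by_cases hk : k = i
        · subst hk; simp
        · simp [hk]
      have ha : (a.filter fun i => i ∉ S).erase i = a.filter fun k => k ∉ insert i S := by
        ext k
        by_cases hk : k = i
        · subst hk; simp
        · simp [Finsupp.erase_ne hk, Finsupp.filter_apply, hk]
      rw [hv, ha] at h
      rw [Finset.prod_insert hi, Finset.prod_insert hi, mul_assoc, ih, mul_smul_comm, h, smul_smul,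
        mul_comm]
  -- what is left is the generating function of the constant `1` on the zero cone, which is `1`
  rw [key Finset.univ]
  ext I
  rw [MvPowerSeries.coeff_smul, coeff_coneSeries, MvPowerSeries.coeff_C]
  have h0 : (a.filter fun i => i ∉ (Finset.univ : Finset ι)) = 0 := by
    ext k; simp
  have hc : (coneForm fun i => if i ∈ (Finset.univ : Finset ι) then 0 else v i) =
      (0 : σ → MvPolynomial ι K) := by
    ext1 j
    simp [coneForm]
  rw [h0, hc, aeval_monomial, Finsupp.prod_fintype _ _ (by simp)]
  split_ifs with hI
  · subst hI
    have := laplaceFunctional_monomial (0 : ι →₀ ℕ) (1 : K)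
    simp at this
    simp [this]
  · obtain ⟨j, hj⟩ := Finsupp.ne_iff.1 hI
    have : ∏ j, (0 : σ → MvPolynomial ι K) j ^ I j = 0 :=
      Finset.prod_eq_zero (Finset.mem_univ j) (by simpa using hj)
    rw [this]
    simp

/-- If all exponents of `g` are at most `δ`, then the poles of its generating function along the
hyperplanes `⟨v_i, u⟩ = 1` have order at most `δ + 1`. -/
lemma exists_prod_affineForm_pow_mul_coneSeries (v : ι → σ → K) (δ : ℕ) (g : MvPolynomial ι K)
    (hg : ∀ a ∈ g.support, ∀ i, a i ≤ δ) :
    ∃ p : MvPolynomial σ K,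
      ((∏ i, affineForm (v i) ^ (δ + 1) : MvPolynomial σ K) : MvPowerSeries σ K) *
        coneSeries v g = p := by
  refine ⟨∑ a ∈ g.support, C (coeff a g * ∏ i, ((a i).factorial : K)) *
    ∏ i, affineForm (v i) ^ (δ - a i), ?_⟩
  have hcoe := map_sum (coeToMvPowerSeries.ringHom (σ := σ) (R := K))
    (fun a => C (coeff a g * ∏ i, ((a i).factorial : K)) * ∏ i, affineForm (v i) ^ (δ - a i))
    g.support
  simp only [coeToMvPowerSeries.ringHom_apply] at hcoe
  rw [hcoe]
  conv_lhs => rw [← support_sum_monomial_coeff g, map_sum, Finset.mul_sum]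
  refine Finset.sum_congr rfl fun a ha => ?_
  have hm : monomial a (coeff a g) = coeff a g • monomial a (1 : K) := by simp [smul_monomial]
  have hp : ∏ i, affineForm (v i) ^ (δ + 1) =
      (∏ i, affineForm (v i) ^ (δ - a i)) * ∏ i, affineForm (v i) ^ (a i + 1) := by
    rw [← Finset.prod_mul_distrib]
    refine Finset.prod_congr rfl fun i _ => ?_
    rw [← pow_add]
    congr 1
    have := hg a ha i
    omega
  have hprod : ((∏ i, affineForm (v i) ^ (a i + 1) : MvPolynomial σ K) : MvPowerSeries σ K) =
      ∏ i, (affineForm (v i) : MvPowerSeries σ K) ^ (a i + 1) := by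
    have := map_prod (coeToMvPowerSeries.ringHom (σ := σ) (R := K))
      (fun i => affineForm (v i) ^ (a i + 1)) Finset.univ
    simpa only [coeToMvPowerSeries.ringHom_apply, coe_pow] using this
  rw [hm, map_smul, hp, coe_mul, hprod, mul_smul_comm, mul_assoc,
    prod_affineForm_pow_mul_coneSeries, coe_mul, coe_C, map_mul, MvPowerSeries.smul_eq_C_mul]
  ring

end FormalLaplace

section Integrals

open MeasureTheory Set

variable {𝕜 : Type*} [RCLike 𝕜] {ι : Type*} [Fintype ι] {d : ℕ}

/-! ### The Laplace integral over an orthant -/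

/-- The function `exp (-∑ s_i) h(s)` on the open positive orthant, extended by zero. -/
noncomputable def orthantIntegrand (h : MvPolynomial ι 𝕜) (s : ι → ℝ) : 𝕜 :=
  open Classical in
  if ∀ i, 0 < s i then (Real.exp (-∑ i, s i) : 𝕜) * eval (fun i => (s i : 𝕜)) h else 0

lemma integrable_gammaIntegrand (n : ℕ) :
    Integrable (fun r : ℝ => (((Ioi 0).indicator (fun r => Real.exp (-r) * r ^ n) r : ℝ) : 𝕜)) := by
  refine Integrable.ofReal ((integrable_indicator_iff measurableSet_Ioi).2 ?_)
  have h := Real.GammaIntegral_convergent (s := n + 1) (by positivity)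
  simpa using h

lemma integral_exp_neg_mul_pow (n : ℕ) :
    ∫ r in Ioi (0 : ℝ), Real.exp (-r) * r ^ n = n.factorial := by
  have h := Real.Gamma_eq_integral (s := n + 1) (by positivity)
  rw [Real.Gamma_nat_eq_factorial] at h
  simpa using h.symm

lemma integral_gammaIntegrand (n : ℕ) :
    ∫ r : ℝ, (((Ioi 0).indicator (fun r => Real.exp (-r) * r ^ n) r : ℝ) : 𝕜) =
      n.factorial := by
  rw [integral_ofReal, integral_indicator measurableSet_Ioi, integral_exp_neg_mul_pow]
  simp

lemma orthantIntegrand_monomial (a : ι →₀ ℕ) (c : 𝕜) (s : ι → ℝ) :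
    orthantIntegrand (monomial a c) s =
      c * ∏ i, (((Ioi 0).indicator (fun r => Real.exp (-r) * r ^ a i) (s i) : ℝ) : 𝕜) := by
  rw [orthantIntegrand]
  split_ifs with h
  · have : ∀ i, (Ioi 0).indicator (fun r : ℝ => Real.exp (-r) * r ^ a i) (s i) =
        Real.exp (-s i) * s i ^ a i := fun i => indicator_of_mem (h i) _
    simp only [this, eval_monomial, ← Finset.sum_neg_distrib, Real.exp_sum]
    rw [Finsupp.prod_fintype _ _ (by simp)]
    push_cast
    rw [Finset.prod_mul_distrib]
    ring
  · push Not at h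
    obtain ⟨i, hi⟩ := h
    rw [Finset.prod_eq_zero (Finset.mem_univ i), mul_zero]
    rw [indicator_of_notMem (by simpa using hi)]
    simp

lemma orthantIntegrand_add (g h : MvPolynomial ι 𝕜) (s : ι → ℝ) :
    orthantIntegrand (g + h) s = orthantIntegrand g s + orthantIntegrand h s := by
  simp only [orthantIntegrand, map_add]
  split_ifs <;> ring

/-- Over `ℝ` and `ℂ`, the formal Laplace functional is the integral against `exp (-∑ s_i)` over the
positive orthant. -/
lemma integral_orthantIntegrand (h : MvPolynomial ι 𝕜) :
    Integrable (orthantIntegrand h) ∧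
      ∫ s, orthantIntegrand h s = laplaceFunctional 𝕜 ι h := by
  induction h using MvPolynomial.induction_on' with
  | monomial a c =>
    have hfun : orthantIntegrand (monomial a c) = fun s : ι → ℝ =>
        c * ∏ i, (((Ioi 0).indicator (fun r => Real.exp (-r) * r ^ a i) (s i) : ℝ) : 𝕜) :=
      funext fun s => orthantIntegrand_monomial a c s
    rw [hfun]
    constructor
    · exact (Integrable.fintype_prod fun i => integrable_gammaIntegrand (a i)).const_mul c
    · rw [integral_const_mul, laplaceFunctional_monomial]
      congr 1
      refine (integral_fintype_prod_volume_eq_prod (E := fun _ => ℝ) fun i r =>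
        (((Ioi 0).indicator (fun r => Real.exp (-r) * r ^ a i) r : ℝ) : 𝕜)).trans ?_
      simp only [integral_gammaIntegrand]
  | add g h hg hh =>
    have hfun : orthantIntegrand (g + h) =
        fun s => orthantIntegrand g s + orthantIntegrand h s :=
      funext fun s => orthantIntegrand_add g h s
    rw [hfun]
    exact ⟨hg.1.add hh.1, by rw [integral_add hg.1 hh.1, hg.2, hh.2, map_add]⟩

/-! ### Moments of a simplex -/

/-- The linear isomorphism of `ℝ^(d+1)` with `ℝ^d × ℝ` that maps the standard basis to the vertices
of `s` at height `1`, and the positive orthant to the open cone over `s`. -/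
noncomputable def coneEquiv (s : Affine.Simplex ℝ (EuclideanSpace ℝ (Fin d)) d) :
    (Fin (d + 1) → ℝ) ≃ₗ[ℝ] EuclideanSpace ℝ (Fin d) × ℝ :=
  LinearMap.linearEquivOfInjective
    ((Fintype.linearCombination ℝ s.points).prod (Fintype.linearCombination ℝ fun _ => (1 : ℝ)))
    (by
      rw [← LinearMap.ker_eq_bot, LinearMap.ker_eq_bot']
      intro w hw
      have h1 : ∑ i, w i • s.points i = 0 := congrArg Prod.fst hw
      have h2 : ∑ i, w i = 0 := by
        simpa [Fintype.linearCombination_apply] using congrArg Prod.snd hw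
      exact funext fun i =>
        affineIndependent_iff.1 s.independent Finset.univ w h2 h1 i (Finset.mem_univ i))
    (by simp)

lemma coneEquiv_apply (s : Affine.Simplex ℝ (EuclideanSpace ℝ (Fin d)) d) (w : Fin (d + 1) → ℝ) :
    coneEquiv s w = (∑ i, w i • s.points i, ∑ i, w i) := by
  simp [coneEquiv, Fintype.linearCombination_apply]

lemma coneEquiv_symm_smul (s : Affine.Simplex ℝ (EuclideanSpace ℝ (Fin d)) d)
    (x : EuclideanSpace ℝ (Fin d)) (t : ℝ) :
    (coneEquiv s).symm (t • x, t) = fun i => t * (simplexBasis s).coord i x := by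
  rw [LinearEquiv.symm_apply_eq, coneEquiv_apply, ← Finset.mul_sum,
    (simplexBasis s).sum_coord_apply_eq_one, mul_one]
  congr 1
  simp only [mul_smul, ← Finset.smul_sum]
  congr 1
  exact ((simplexBasis s).linear_combination_coord_eq_self x).symm

lemma sum_coneEquiv_symm (s : Affine.Simplex ℝ (EuclideanSpace ℝ (Fin d)) d)
    (p : EuclideanSpace ℝ (Fin d) × ℝ) : ∑ i, (coneEquiv s).symm p i = p.2 := by
  conv_rhs => rw [← (coneEquiv s).apply_symm_apply p, coneEquiv_apply]

lemma eval_smul_of_isHomogeneous {σ R : Type*} [Fintype σ] [CommSemiring R] {g : MvPolynomial σ R}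
    {n : ℕ} (hg : g.IsHomogeneous n) (c : R) (x : σ → R) :
    eval (fun j => c * x j) g = c ^ n * eval x g := by
  rw [eval_eq', eval_eq', Finset.mul_sum]
  refine Finset.sum_congr rfl fun a ha => ?_
  have : ∑ j, a j = n := by
    rw [← hg (mem_support_iff.1 ha), Finsupp.weight_apply, Finsupp.sum_fintype _ _ (by simp)]
    simp
  simp only [mul_pow, Finset.prod_mul_distrib, Finset.prod_pow_eq_pow_sum, this]
  ring

/-- The vertices of a simplex, with real or complex coordinates. -/
def vertexCoords (𝕜 : Type*) [RCLike 𝕜] (s : Affine.Simplex ℝ (EuclideanSpace ℝ (Fin d)) d)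
    (i : Fin (d + 1)) (j : Fin d) : 𝕜 :=
  (s.points i j : 𝕜)

lemma eval_aeval_coneForm (s : Affine.Simplex ℝ (EuclideanSpace ℝ (Fin d)) d)
    (g : MvPolynomial (Fin d) 𝕜) (w : Fin (d + 1) → ℝ) :
    eval (fun i => (w i : 𝕜)) (aeval (coneForm (vertexCoords 𝕜 s)) g) =
      eval (fun j => ((coneEquiv s w).1 j : 𝕜)) g := by
  rw [← coe_aeval_eq_eval, RingHom.coe_coe, ← AlgHom.comp_apply, comp_aeval, coneEquiv_apply,
    ← coe_aeval_eq_eval, RingHom.coe_coe]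
  congr 2
  ext1 j
  simp [coneForm, vertexCoords, mul_comm]

/-- The integral of a homogeneous polynomial over a simplex is, up to a factorial, its Laplace
integral over the cone on the simplex. The Jacobian of the parametrization of this cone enters only
through its being a constant. -/
lemma exists_factorial_mul_integral_openSimplex (𝕜 : Type*) [RCLike 𝕜]
    (s : Affine.Simplex ℝ (EuclideanSpace ℝ (Fin d)) d) :
    ∃ c : 𝕜, ∀ (n : ℕ) (g : MvPolynomial (Fin d) 𝕜), g.IsHomogeneous n →
      ((n + d).factorial : 𝕜) * ∫ x in openSimplex s, eval (fun j => (x j : 𝕜)) g =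
        c * laplaceFunctional 𝕜 (Fin (d + 1)) (aeval (coneForm (vertexCoords 𝕜 s)) g) := by
  classical
  let e : (Fin (d + 1) → ℝ) ≃ᵐ EuclideanSpace ℝ (Fin d) × ℝ :=
    (coneEquiv s).toContinuousLinearEquiv.toHomeomorph.toMeasurableEquiv
  have he : ∀ w, e w = coneEquiv s w := fun _ => rfl
  let ν : Measure (EuclideanSpace ℝ (Fin d) × ℝ) := Measure.map e volume
  have hν : ν.IsAddHaarMeasure :=
    (coneEquiv s).toContinuousLinearEquiv.isAddHaarMeasure_map volume
  have hvol : (volume : Measure (EuclideanSpace ℝ (Fin d) × ℝ)).IsAddHaarMeasure :=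
    Measure.prod.instIsAddHaarMeasure _ _
  obtain ⟨c, hc⟩ : ∃ c : NNReal, (volume : Measure (EuclideanSpace ℝ (Fin d) × ℝ)) = c • ν :=
    ⟨_, Measure.isAddLeftInvariant_eq_smul volume ν⟩
  refine ⟨((c : ℝ) : 𝕜), fun n g hg => ?_⟩
  set h := aeval (coneForm (vertexCoords 𝕜 s)) g with hh
  let G : EuclideanSpace ℝ (Fin d) × ℝ → 𝕜 := fun p => orthantIntegrand h ((coneEquiv s).symm p)
  have hGe : G ∘ e = orthantIntegrand h := by
    ext1 w
    simp [G, he]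
  have hint : Integrable G volume := by
    rw [hc]
    refine Integrable.smul_measure_nnreal ?_
    rw [integrable_map_equiv, hGe]
    exact (integral_orthantIntegrand h).1
  have hval : ∫ p, G p = ((c : ℝ) : 𝕜) * laplaceFunctional 𝕜 (Fin (d + 1)) h := by
    rw [hc, integral_smul_nnreal_measure, integral_map_equiv, ← (integral_orthantIntegrand h).2,
      NNReal.smul_def, RCLike.real_smul_eq_coe_mul]
    congr 2
  have hGt : ∀ (t : ℝ) (x), G (x, t) = if ∀ i, 0 < (coneEquiv s).symm (x, t) i then
      (Real.exp (-t) : 𝕜) * eval (fun j => (x j : 𝕜)) g else 0 := by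
    intro t x
    simp only [G, orthantIntegrand, sum_coneEquiv_symm, hh, eval_aeval_coneForm,
      LinearEquiv.apply_symm_apply]
  have hslice : ∀ t : ℝ, ∫ x, G (x, t) =
      (((Ioi 0).indicator (fun r => Real.exp (-r) * r ^ (n + d)) t : ℝ) : 𝕜) *
        ∫ x in openSimplex s, eval (fun j => (x j : 𝕜)) g := by
    intro t
    rcases le_or_gt t 0 with ht | ht
    · have h0 : ∀ x, G (x, t) = 0 := by
        intro x
        rw [hGt, if_neg]
        intro hpos
        have := Finset.sum_pos (fun i _ => hpos i) Finset.univ_nonempty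
        rw [sum_coneEquiv_symm] at this
        exact absurd this (not_lt.2 ht)
      simp only [h0, integral_zero]
      rw [indicator_of_notMem (by simpa using ht)]
      simp
    · have hscale : ∀ y : EuclideanSpace ℝ (Fin d), G (t • y, t) =
          ((Real.exp (-t) * t ^ n : ℝ) : 𝕜) *
            (openSimplex s).indicator (fun x => eval (fun j => (x j : 𝕜)) g) y := by
        intro y
        have hmem : (∀ i, 0 < (coneEquiv s).symm (t • y, t) i) ↔ y ∈ openSimplex s := by
          rw [coneEquiv_symm_smul, mem_openSimplex]
          exact forall_congr' fun i => mul_pos_iff_of_pos_left ht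
        have hev := eval_smul_of_isHomogeneous hg (t : 𝕜) (fun j => (y j : 𝕜))
        rw [hGt]
        by_cases hy : y ∈ openSimplex s
        · rw [if_pos (hmem.2 hy), indicator_of_mem hy]
          simp only [PiLp.smul_apply, smul_eq_mul, RCLike.ofReal_mul, hev, RCLike.ofReal_pow]
          ring
        · rw [if_neg (fun H => hy (hmem.1 H)), indicator_of_notMem hy, mul_zero]
      -- the slice of the cone at height `t` is `t • openSimplex s`
      have hcomp := Measure.integral_comp_smul volume (fun x => G (x, t)) t
      simp only [hscale] at hcomp
      rw [integral_const_mul, integral_indicator (isOpen_openSimplex s).measurableSet,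
        finrank_euclideanSpace_fin, abs_of_pos (by positivity), eq_inv_smul_iff₀ (by positivity),
        RCLike.real_smul_eq_coe_mul] at hcomp
      rw [← hcomp, indicator_of_mem (mem_Ioi.2 ht), ← mul_assoc]
      congr 1
      push_cast
      ring
  have hfub : ∫ p, G p = ∫ t : ℝ, ∫ x, G (x, t) := integral_prod_symm G hint
  simp only [hslice] at hfub
  rw [integral_mul_const, integral_gammaIntegrand] at hfub
  rw [← hfub, hval]

end Integrals

/-! ### Moments of a dissected set -/

section Moments

open MeasureTheory Set

variable {𝕜 : Type*} [RCLike 𝕜] {d : ℕ}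

lemma moment_standardMeasure (P : Set (EuclideanSpace ℝ (Fin d))) (ρ : MvPolynomial (Fin d) 𝕜)
    (I : Fin d →₀ ℕ) :
    moment (standardMeasure P) ρ I =
      ∫ x in P, eval (fun j => (x j : 𝕜)) (monomial I (1 : 𝕜) * ρ) := by
  simp only [moment, standardMeasure, map_mul, eval_monomial, one_mul,
    Finsupp.prod_fintype _ _ fun _ => pow_zero _]

lemma coeff_momentGenFun (μ : Measure (EuclideanSpace ℝ (Fin d))) (δ : ℕ)
    (ρ : MvPolynomial (Fin d) 𝕜) (I : Fin d →₀ ℕ) :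
    MvPowerSeries.coeff I (momentGenFun μ δ ρ) =
      (((∑ j, I j) + d + δ).factorial : 𝕜) / (∏ j, ((I j).factorial : 𝕜)) * moment μ ρ I := rfl

lemma exists_momentGenFun_openSimplex (s : Affine.Simplex ℝ (EuclideanSpace ℝ (Fin d)) d) {δ : ℕ}
    {ρ : MvPolynomial (Fin d) 𝕜} (hρ : ρ.IsHomogeneous δ) :
    ∃ c : 𝕜, momentGenFun (standardMeasure (openSimplex s)) δ ρ =
      c • coneSeries (vertexCoords 𝕜 s) (aeval (coneForm (vertexCoords 𝕜 s)) ρ) := by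
  obtain ⟨c, hc⟩ := exists_factorial_mul_integral_openSimplex 𝕜 s
  refine ⟨c, ?_⟩
  ext I
  have hI : (monomial I (1 : 𝕜)).IsHomogeneous (∑ j, I j) :=
    isHomogeneous_monomial 1 (Finsupp.degree_eq_sum I)
  have h := hc _ _ (hI.mul hρ)
  rw [map_mul, add_right_comm] at h
  rw [coeff_momentGenFun, moment_standardMeasure, MvPowerSeries.coeff_smul, coeff_coneSeries,
    div_mul_eq_mul_div, h]
  ring

lemma integrableOn_eval (p : MvPolynomial (Fin d) 𝕜) {A : Set (EuclideanSpace ℝ (Fin d))}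
    (hA : IsCompact A) : IntegrableOn (fun x => eval (fun j => (x j : 𝕜)) p) A := by
  refine ContinuousOn.integrableOn_compact hA (Continuous.continuousOn ?_)
  have : Continuous fun x : EuclideanSpace ℝ (Fin d) => fun j => (x j : 𝕜) := by fun_prop
  exact p.continuous_eval.comp this

lemma IsDissection.momentGenFun_eq {T : Finset (Affine.Simplex ℝ (EuclideanSpace ℝ (Fin d)) d)}
    {P : Set (EuclideanSpace ℝ (Fin d))} (hT : IsDissection T P) (δ : ℕ)
    (ρ : MvPolynomial (Fin d) 𝕜) :
    momentGenFun (standardMeasure P) δ ρ =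
      ∑ s ∈ T, momentGenFun (standardMeasure (openSimplex s)) δ ρ := by
  have hnull : P =ᵐ[volume] ⋃ s ∈ T, openSimplex s := by
    rw [← (isDissection_iff.1 hT).2]
    refine Filter.EventuallyEq.symm (LE.le.eventuallyLE
      (iUnion₂_mono fun s _ => openSimplex_subset_closedSimplex s) |>.antisymm ?_)
    rw [ae_le_set]
    refine measure_mono_null (t := ⋃ s ∈ T, frontier (closedSimplex s)) ?_
      ((measure_biUnion_null_iff T.countable_toSet).2 fun s _ =>
        (convex_closedSimplex s).addHaar_frontier volume)
    rintro x ⟨hx, hx'⟩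
    simp only [mem_iUnion, exists_prop, not_exists, not_and] at hx hx' ⊢
    obtain ⟨s, hs, hxs⟩ := hx
    exact ⟨s, hs, subset_closure hxs, hx' s hs⟩
  ext I
  rw [map_sum]
  simp only [coeff_momentGenFun, moment_standardMeasure]
  rw [setIntegral_congr_set hnull, integral_biUnion_finset T
    (fun s _ => (isOpen_openSimplex s).measurableSet) hT.1
    (fun s _ => (integrableOn_eval _ (isCompact_closedSimplex s)).mono_set
      (openSimplex_subset_closedSimplex s)), Finset.mul_sum]

/-- The vertices of the simplices in `T`. -/
noncomputable def vertexFinset (T : Finset (Affine.Simplex ℝ (EuclideanSpace ℝ (Fin d)) d)) :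
    Finset (EuclideanSpace ℝ (Fin d)) :=
  open Classical in T.biUnion fun s => Finset.univ.image s.points

lemma mem_vertexFinset {T : Finset (Affine.Simplex ℝ (EuclideanSpace ℝ (Fin d)) d)}
    {v : EuclideanSpace ℝ (Fin d)} : v ∈ vertexFinset T ↔ ∃ s ∈ T, v ∈ range s.points := by
  simp [vertexFinset]

/-- Every dissection provides a representation of the generating function as a fraction. -/
lemma IsDissection.exists_mul_momentGenFun
    {T : Finset (Affine.Simplex ℝ (EuclideanSpace ℝ (Fin d)) d)}
    {P : Set (EuclideanSpace ℝ (Fin d))} (hT : IsDissection T P) {δ : ℕ}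
    {ρ : MvPolynomial (Fin d) 𝕜} (hρ : ρ.IsHomogeneous δ) :
    ∃ p : MvPolynomial (Fin d) 𝕜,
      ((∏ v ∈ vertexFinset T, dualForm 𝕜 v ^ (δ + 1) : MvPolynomial (Fin d) 𝕜) :
        MvPowerSeries (Fin d) 𝕜) * momentGenFun (standardMeasure P) δ ρ = p := by
  classical
  have hs : ∀ s ∈ T, ∃ p : MvPolynomial (Fin d) 𝕜,
      ((∏ v ∈ vertexFinset T, dualForm 𝕜 v ^ (δ + 1) : MvPolynomial (Fin d) 𝕜) :
        MvPowerSeries (Fin d) 𝕜) * momentGenFun (standardMeasure (openSimplex s)) δ ρ = p := by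
    intro s hs
    obtain ⟨c, hc⟩ := exists_momentGenFun_openSimplex s hρ
    have hhom : (aeval (coneForm (vertexCoords 𝕜 s)) ρ).IsHomogeneous δ := by
      have := hρ.aeval (coneForm (vertexCoords 𝕜 s)) (n := 1) fun j =>
        IsHomogeneous.sum _ _ _ fun i _ => isHomogeneous_C_mul_X _ _
      rwa [one_mul] at this
    obtain ⟨p, hp⟩ := exists_prod_affineForm_pow_mul_coneSeries (vertexCoords 𝕜 s) δ
      (aeval (coneForm (vertexCoords 𝕜 s)) ρ) (by
        intro a ha i
        have h := hhom.degree_eq_sum_deg_support ha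
        rw [h]
        exact Finsupp.le_degree i a)
    have himage : ∏ i, affineForm (vertexCoords 𝕜 s i) ^ (δ + 1) =
        ∏ v ∈ Finset.univ.image s.points, dualForm 𝕜 v ^ (δ + 1) := by
      rw [Finset.prod_image fun i _ j _ h => s.independent.injective h]
      rfl
    obtain ⟨r, hr⟩ : ∏ i, affineForm (vertexCoords 𝕜 s i) ^ (δ + 1) ∣
        ∏ v ∈ vertexFinset T, dualForm 𝕜 v ^ (δ + 1) := by
      rw [himage]
      exact Finset.prod_dvd_prod_of_subset _ _ _
        (Finset.subset_biUnion_of_mem (fun s => Finset.univ.image s.points) hs)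
    refine ⟨r * (C c * p), ?_⟩
    rw [hr, hc, coe_mul, coe_mul, coe_mul, coe_C, ← hp, MvPowerSeries.smul_eq_C_mul]
    ring
  choose! p hp using hs
  refine ⟨∑ s ∈ T, p s, ?_⟩
  have hcoe := map_sum (coeToMvPowerSeries.ringHom (σ := Fin d) (R := 𝕜)) p T
  simp only [coeToMvPowerSeries.ringHom_apply] at hcoe
  rw [hcoe, hT.momentGenFun_eq, Finset.mul_sum]
  exact Finset.sum_congr rfl hp

end Moments

/-! ### Denominators -/

section Denominators

variable {𝕜 : Type*} [RCLike 𝕜] {d : ℕ}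

lemma constantCoeff_dualForm (v : EuclideanSpace ℝ (Fin d)) :
    constantCoeff (dualForm 𝕜 v) = 1 := by
  simp [dualForm]

lemma dualForm_ne_zero (v : EuclideanSpace ℝ (Fin d)) : dualForm 𝕜 v ≠ 0 := by
  intro h
  simpa [h] using constantCoeff_dualForm (𝕜 := 𝕜) v

lemma totalDegree_dualForm_le (v : EuclideanSpace ℝ (Fin d)) :
    (dualForm 𝕜 v).totalDegree ≤ 1 := by
  refine (totalDegree_sub _ _).trans (max_le (by simp) ?_)
  exact totalDegree_finsetSum_le fun j _ => (isHomogeneous_C_mul_X _ _).totalDegree_le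

lemma dualForm_injective : Function.Injective (dualForm 𝕜 (d := d)) := by
  classical
  intro v w h
  ext j
  have hc : ∀ v : EuclideanSpace ℝ (Fin d),
      coeff (Finsupp.single j 1) (dualForm 𝕜 v) = -(v j : 𝕜) := by
    intro v
    have h1 : coeff (Finsupp.single j 1) (1 : MvPolynomial (Fin d) 𝕜) = 0 := by
      rw [coeff_one, if_neg]
      exact (Finsupp.single_ne_zero.2 one_ne_zero).symm
    rw [dualForm, coeff_sub, h1, coeff_sum, Finset.sum_eq_single j]
    · simp
    · intro k _ hk
      rw [coeff_C_mul, coeff_X, if_neg, mul_zero]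
      exact fun h => hk (Finsupp.single_left_injective one_ne_zero h)
    · simp
  have := congrArg (coeff (Finsupp.single j 1)) h
  rw [hc, hc, neg_inj] at this
  exact_mod_cast this

/-- A nonconstant common divisor of two polynomials of degree one makes them proportional, and the
constant coefficients of the forms `1 - ⟨v, u⟩` are all `1`. -/
lemma isRelPrime_dualForm {v w : EuclideanSpace ℝ (Fin d)} (hvw : v ≠ w) :
    IsRelPrime (dualForm 𝕜 v) (dualForm 𝕜 w) := by
  intro r hrv hrw
  have hr : r ≠ 0 := fun h => dualForm_ne_zero (𝕜 := 𝕜) v (zero_dvd_iff.1 (h ▸ hrv))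
  by_cases h0 : r.totalDegree = 0
  · rw [totalDegree_eq_zero_iff_eq_C.1 h0] at hr ⊢
    exact (IsUnit.mk0 _ fun h => hr (by rw [h, C_0])).map C
  have hprop : ∀ v : EuclideanSpace ℝ (Fin d), r ∣ dualForm 𝕜 v →
      constantCoeff r ≠ 0 ∧ dualForm 𝕜 v = C (constantCoeff r)⁻¹ * r := by
    rintro v ⟨a, ha⟩
    have ha0 : a ≠ 0 := fun h => dualForm_ne_zero (𝕜 := 𝕜) v (by rw [ha, h, mul_zero])
    have hdeg := totalDegree_dualForm_le (𝕜 := 𝕜) v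
    rw [ha, totalDegree_mul_of_isDomain hr ha0] at hdeg
    have haC := totalDegree_eq_zero_iff_eq_C.1 (show a.totalDegree = 0 by omega)
    have hc := constantCoeff_dualForm (𝕜 := 𝕜) v
    rw [ha, haC, map_mul, constantCoeff_C] at hc
    refine ⟨left_ne_zero_of_mul (hc ▸ one_ne_zero), ?_⟩
    rw [ha, haC, ← eq_inv_of_mul_eq_one_right hc, mul_comm]
  exact absurd (dualForm_injective ((hprop v hrv).2.trans (hprop w hrw).2.symm)) hvw

/-- The denominator in lowest terms divides the one that comes from any dissection, hence the
greatest common divisor of all of these, in which only the common vertices survive. -/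
theorem IsGeneralizedPolytope.exists_hasDenominatorDividing
    {P : Set (EuclideanSpace ℝ (Fin d))} (hP : IsGeneralizedPolytope P) {δ : ℕ}
    {ρ : MvPolynomial (Fin d) 𝕜} (hρ : ρ.IsHomogeneous δ) :
    ∃ hfin : (vertices P).Finite,
      HasDenominatorDividing (momentGenFun (standardMeasure P) δ ρ)
        (∏ v ∈ hfin.toFinset, dualForm 𝕜 v ^ (δ + 1)) := by
  classical
  obtain ⟨T₀, hT₀⟩ := hP.exists_isDissection
  have hsub : vertices P ⊆ vertexFinset T₀ := fun v hv => mem_vertexFinset.2 (hv T₀ hT₀)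
  have hfin : (vertices P).Finite := (vertexFinset T₀).finite_toSet.subset hsub
  refine ⟨hfin, ?_⟩
  set F := momentGenFun (standardMeasure P) δ ρ
  let Φ : Finset (EuclideanSpace ℝ (Fin d)) → MvPolynomial (Fin d) 𝕜 :=
    fun V => ∏ v ∈ V, dualForm 𝕜 v ^ (δ + 1)
  have hΦ : ∀ V, Φ V ≠ 0 := fun V =>
    Finset.prod_ne_zero_iff.2 fun v _ => pow_ne_zero _ (dualForm_ne_zero v)
  obtain ⟨p₀, hp₀⟩ := hT₀.exists_mul_momentGenFun hρ
  obtain ⟨q, p, g, hqp, hgq, hgp⟩ :=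
    UniqueFactorizationMonoid.exists_reduced_factors (Φ (vertexFinset T₀)) (hΦ _) p₀
  have hg : g ≠ 0 := fun h => hΦ (vertexFinset T₀) (by rw [← hgq, h, zero_mul])
  have hq : q ≠ 0 := fun h => hΦ (vertexFinset T₀) (by rw [← hgq, h, mul_zero])
  have hqF : (q : MvPowerSeries (Fin d) 𝕜) * F = p := by
    have h : (g : MvPowerSeries (Fin d) 𝕜) * (q * F - p) = 0 := by
      rw [mul_sub, ← mul_assoc, ← coe_mul, ← coe_mul, hgq, hgp, sub_eq_zero]
      exact hp₀
    exact sub_eq_zero.1 ((mul_eq_zero.1 h).resolve_left fun h => hg (coe_eq_zero_iff.1 h))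
  -- a denominator in lowest terms divides the denominator of every other representation
  have hdvd : ∀ T, IsDissection T P → q ∣ Φ (vertexFinset T) := by
    intro T hT
    obtain ⟨pT, hpT⟩ := hT.exists_mul_momentGenFun hρ
    have h : Φ (vertexFinset T) * p = q * pT := by
      apply coe_injective
      rw [coe_mul, coe_mul, ← hpT, ← hqF]
      ring
    exact hqp.dvd_of_dvd_mul_right ⟨pT, h⟩
  refine ⟨p, q, hq, hqp.symm, hqF, ?_⟩
  have hsplit : Φ (vertexFinset T₀) = Φ (vertexFinset T₀ \ hfin.toFinset) * Φ hfin.toFinset :=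
    (Finset.prod_sdiff fun v hv => hsub (hfin.mem_toFinset.1 hv)).symm
  refine IsRelPrime.dvd_of_dvd_mul_left (IsRelPrime.prod_right fun v hv => ?_)
    (hsplit ▸ hdvd T₀ hT₀)
  -- a point outside `vertices P` is missed by some dissection
  obtain ⟨T, hT, hvT⟩ : ∃ T, IsDissection T P ∧ v ∉ vertexFinset T := by
    have hv' : v ∉ vertices P := fun h => (Finset.mem_sdiff.1 hv).2 (hfin.mem_toFinset.2 h)
    simp only [vertices, Set.mem_ofPred_eq, not_forall] at hv'
    obtain ⟨T, hT, hvT⟩ := hv'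
    exact ⟨T, hT, fun h => hvT (mem_vertexFinset.1 h)⟩
  refine IsRelPrime.of_dvd_left (IsRelPrime.prod_left fun w hw => ?_) (hdvd T hT)
  exact (isRelPrime_dualForm fun h : w = v => hvT (h ▸ hw)).pow

end Denominators

end PolytopeMoments

theorem proposition1p7 {𝕜 : Type*} [RCLike 𝕜] (d : ℕ) (P : Set (EuclideanSpace ℝ (Fin d)))
    (hP : PolytopeMoments.IsGeneralizedPolytope P) (δ : ℕ) (ρ : MvPolynomial (Fin d) 𝕜)
    (hρ : ρ.IsHomogeneous δ) :
    ∃ hfin : (PolytopeMoments.vertices P).Finite,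
      PolytopeMoments.HasDenominatorDividing
        (PolytopeMoments.momentGenFun (PolytopeMoments.standardMeasure P) δ ρ)
        (∏ v ∈ hfin.toFinset, PolytopeMoments.dualForm 𝕜 v ^ (δ + 1)) :=
  hP.exists_hasDenominatorDividing hρ
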